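/- For $N\in\mathbb N$ and $f\colon\{-1,1\}^N\to\mathbb R$ write $\widehat f(S)=2^{-N}\sum_{x\in\{-1,1\}^N} f(x)\prod_{k\in S}x_k$ for $S\subseteq\{1,\dots,N\}$ and $\|f\|_\infty=\max_{x\in\{-1,1\}^N}|f(x)|$. The Boolean radius $\rho(f)$ of $f$ is the positive real number $\rho$ satisfying $$\sum_{S\subseteq\{1,\dots,N\}}|\widehat f(S)|\,\rho^{|S|}=\|f\|_\infty .$$ For $\alpha\in\mathbb R$ let $\psi_{N,\alpha}\colon\{-1,1\}^N\to\{-1,1\}$, $\psi_{N,\alpha}(x)=\operatorname{sign}(x_1+\dots+x_N-\alpha)$, where $\operatorname{sign}(y)=1$ for $y\ge 0$ and $\operatorname{sign}(y)=-1$ for $y<0$. **Theorem.** There is an absolute constant $C>0$ such that for all $N\in\mathbb N$ and all real $\alpha$ with $0\le\alpha<N$, the Boolean radius $\rho(\psi_{N,\alpha})$ is well defined (exactly one such positive number exists) and $$C^{-1}\,\frac{1}{\alpha+\sqrt N}\;\le\;\rho(\psi_{N,\alpha})\;\le\; C\,\frac{1}{\alpha+\sqrt N}.$$ -/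

import Mathlib

open scoped BigOperators

noncomputable section

namespace BooleanCube

/-- The Boolean cube `{-1, 1}^N`; the units of `ℤ` are exactly `1` and `-1`. -/
abbrev Cube (N : ℕ) : Type := Fin N → ℤˣ

/-- The `k`-th coordinate of a point of the cube, as a real number. -/
def coord {N : ℕ} (x : Cube N) (k : Fin N) : ℝ := ((x k : ℤ) : ℝ)

/-- The expectation with respect to the uniform probability on the cube. -/
def expectation {N : ℕ} (f : Cube N → ℝ) : ℝ := (1 / 2 ^ N) * ∑ x : Cube N, f x

/-- The Walsh function `x ↦ ∏ k ∈ S, x k`. -/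
def walsh {N : ℕ} (S : Finset (Fin N)) (x : Cube N) : ℝ := ∏ k ∈ S, coord x k

/-- The Fourier-Walsh coefficient of `f` at `S`. -/
def walshCoeff {N : ℕ} (f : Cube N → ℝ) (S : Finset (Fin N)) : ℝ :=
  expectation fun x => f x * walsh S x

/-- The supremum norm of a function on the cube. -/
def supNorm {N : ℕ} (f : Cube N → ℝ) : ℝ := ⨆ x : Cube N, |f x|

/-- `ρ` is a Boolean radius of `f`: a positive real number which satisfies
`∑ S, |walshCoeff f S| * ρ ^ |S| = ‖f‖_∞`. -/
def IsBooleanRadius {N : ℕ} (f : Cube N → ℝ) (ρ : ℝ) : Prop :=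
  0 < ρ ∧ ∑ S : Finset (Fin N), |walshCoeff f S| * ρ ^ S.card = supNorm f

/-- The sign function with the convention that the sign of `0` is `1`. -/
def sgn (y : ℝ) : ℝ := if 0 ≤ y then 1 else -1

/-- The threshold function `x ↦ sgn (x_1 + ⋯ + x_N - α)`. -/
def threshold (N : ℕ) (α : ℝ) (x : Cube N) : ℝ := sgn (∑ k : Fin N, coord x k - α)

end BooleanCube

end

open scoped BigOperators

noncomputable section

namespace BooleanCube

/-! ### Expectation on the cube -/

/-! Write `T` for the sum of the coordinates, `p` for the probability that `T ≥ α`, and `m` for the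
mean of `T` times the indicator of that event. The coefficient at `∅` is `2p - 1`, and `p ≤ 3/4`, so
its absolute value lies between `1 - 2p` and `1 - p/2`. At the Boolean radius the remaining levels
must therefore add up to something between `p/2` and `2p`.

Upper bound: the first level contributes at least `2mρ`, so `ρ ≤ p/m`. The conditional mean `m/p` is
at least `(α + √N)/9` by `mul_expectation_tailInd_le`.

Lower bound: by symmetry, the absolute sum over level `d` is the absolute mean of the indicator
times the elementary symmetric function `e_d(x)`. Pairing opposite coordinates gives `∑ |e_d(x)| r^d
≤ exp (r²N/2 + rT)` for `T ≥ 0` (`sum_abs_coeff_genPoly_le`). As `p` may be exponentially small, the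
tail exponential moment must be compared with `p` itself; `expectation_exp_mul_tailInd_le` does
this. For `r` a small multiple of `1/(α + √N)` the nonempty levels then sum to less than `p/2`. -/

lemma expectation_add {N : ℕ} (f g : Cube N → ℝ) :
    expectation (fun x => f x + g x) = expectation f + expectation g := by
  simp only [expectation, Finset.sum_add_distrib, mul_add]

lemma expectation_sub {N : ℕ} (f g : Cube N → ℝ) :
    expectation (fun x => f x - g x) = expectation f - expectation g := by
  simp only [expectation, Finset.sum_sub_distrib, mul_sub]

lemma expectation_const_mul {N : ℕ} (c : ℝ) (f : Cube N → ℝ) :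
    expectation (fun x => c * f x) = c * expectation f := by
  simp only [expectation, ← Finset.mul_sum]
  ring

lemma expectation_sum {N : ℕ} {ι : Type*} (s : Finset ι) (f : ι → Cube N → ℝ) :
    expectation (fun x => ∑ i ∈ s, f i x) = ∑ i ∈ s, expectation (f i) := by
  simp only [expectation, ← Finset.mul_sum]
  rw [Finset.sum_comm]

lemma expectation_mono {N : ℕ} {f g : Cube N → ℝ} (h : ∀ x, f x ≤ g x) :
    expectation f ≤ expectation g :=
  mul_le_mul_of_nonneg_left (Finset.sum_le_sum fun x _ => h x) (by positivity)

lemma abs_expectation_le {N : ℕ} (f : Cube N → ℝ) :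
    |expectation f| ≤ expectation fun x => |f x| := by
  unfold expectation
  rw [abs_mul, abs_of_nonneg (by positivity : (0 : ℝ) ≤ 1 / 2 ^ N)]
  exact mul_le_mul_of_nonneg_left (Finset.abs_sum_le_sum_abs _ _) (by positivity)

lemma expectation_comp_equiv {N : ℕ} (e : Cube N ≃ Cube N) (f : Cube N → ℝ) :
    expectation (fun x => f (e x)) = expectation f := by
  unfold expectation
  rw [Equiv.sum_comp e f]

lemma expectation_const {N : ℕ} (c : ℝ) : expectation (fun _ : Cube N => c) = c := by
  simp [expectation]

lemma expectation_nonneg {N : ℕ} {f : Cube N → ℝ} (h : ∀ x, 0 ≤ f x) : 0 ≤ expectation f :=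
  mul_nonneg (by positivity) (Finset.sum_nonneg fun x _ => h x)

lemma expectation_pos {N : ℕ} {f : Cube N → ℝ} (h : ∀ x, 0 ≤ f x) {y : Cube N} (hy : 0 < f y) :
    0 < expectation f :=
  mul_pos (by positivity) (Finset.sum_pos' (fun x _ => h x) ⟨y, Finset.mem_univ _, hy⟩)

/-- Conditioning on the first coordinate. -/
lemma expectation_succ {N : ℕ} (f : Cube (N + 1) → ℝ) :
    expectation f = (expectation (fun x : Cube N => f (Fin.cons 1 x)) +
      expectation (fun x : Cube N => f (Fin.cons (-1) x))) / 2 := by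
  unfold expectation
  rw [← (Fin.consEquiv fun _ : Fin (N + 1) => ℤˣ).sum_comp f, Fintype.sum_prod_type]
  have : (Finset.univ : Finset ℤˣ) = {1, -1} := rfl
  rw [this, Finset.sum_pair (by decide)]
  simp only [Fin.consEquiv, Equiv.coe_fn_mk]
  field_simp
  ring

/-! ### The sum of the coordinates -/

/-- The sum of the coordinates. -/
def total {N : ℕ} (x : Cube N) : ℝ := ∑ k, coord x k

lemma total_zero (x : Cube 0) : total x = 0 := by simp [total]

lemma total_cons {N : ℕ} (u : ℤˣ) (x : Cube N) :
    total (Fin.cons u x : Cube (N + 1)) = ((u : ℤ) : ℝ) + total x := by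
  simp [total, coord, Fin.sum_univ_succ]

lemma total_neg {N : ℕ} (x : Cube N) : total (-x) = -total x := by
  simp [total, coord]

lemma total_eq_intCast {N : ℕ} (x : Cube N) : ∃ z : ℤ, total x = z :=
  ⟨∑ k, (x k : ℤ), by simp [total, coord]⟩

lemma expectation_total_succ {N : ℕ} (g : ℝ → ℝ) :
    expectation (fun x : Cube (N + 1) => g (total x)) =
      (expectation (fun x : Cube N => g (total x + 1)) +
        expectation (fun x : Cube N => g (total x - 1))) / 2 := by
  rw [expectation_succ]
  simp only [total_cons]
  congr 3 <;> ext x <;> congr 1 <;> push_cast <;> ring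

lemma expectation_total_neg {N : ℕ} (g : ℝ → ℝ) :
    expectation (fun x : Cube N => g (-total x)) = expectation (fun x : Cube N => g (total x)) := by
  rw [← expectation_comp_equiv (Equiv.neg _) (fun x : Cube N => g (total x))]
  simp only [Equiv.neg_apply, total_neg]

lemma expectation_total_sq (N : ℕ) : expectation (fun x : Cube N => total x ^ 2) = N := by
  induction N with
  | zero => simp [total_zero, expectation_const]
  | succ N ih =>
    rw [expectation_total_succ (fun t => t ^ 2), ← expectation_add]
    have : (fun x : Cube N => (total x + 1) ^ 2 + (total x - 1) ^ 2) =
        fun x => 2 * total x ^ 2 + 2 := by ext; ring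
    rw [this, expectation_add, expectation_const_mul, expectation_const, ih]
    push_cast; ring

lemma expectation_total_pow_four (N : ℕ) :
    expectation (fun x : Cube N => total x ^ 4) = 3 * N ^ 2 - 2 * N := by
  induction N with
  | zero => simp [total_zero, expectation_const]
  | succ N ih =>
    rw [expectation_total_succ (fun t => t ^ 4), ← expectation_add]
    have : (fun x : Cube N => (total x + 1) ^ 4 + (total x - 1) ^ 4) =
        fun x => 2 * total x ^ 4 + (12 * total x ^ 2 + 2) := by ext; ring
    rw [this, expectation_add, expectation_add, expectation_const_mul, expectation_const_mul,
      expectation_const, ih, expectation_total_sq]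
    push_cast; ring

/-- Bounds `y` below by even powers, so that second and fourth moments control a first absolute
moment. -/
lemma sub_sq_add_pow_four_nonneg {y : ℝ} (hy : 0 ≤ y) : 0 ≤ y - y ^ 2 + y ^ 4 / 4 := by
  have : 0 ≤ y * (1 - y + y ^ 3 / 4) :=
    mul_nonneg hy (by nlinarith [mul_nonneg hy (sq_nonneg (y - 1)), sq_nonneg (y - 1)])
  linarith

/-- A lower Khinchine inequality. -/
lemma sqrt_div_four_le_expectation_abs_total (N : ℕ) :
    √(N : ℝ) / 4 ≤ expectation (fun x : Cube N => |total x|) := by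
  rcases Nat.eq_zero_or_pos N with rfl | hN
  · simp [total_zero, expectation_const]
  set s := √(N : ℝ)
  have hs : 0 < s := Real.sqrt_pos.2 (by exact_mod_cast hN)
  have hsN : s ^ 2 = N := Real.sq_sqrt (by positivity)
  -- The polynomial inequality at `y = |T|/√N`, scaled by `√N`. In the mean the right constant
  -- appears as `1 - 3/4`.
  have key : ∀ x : Cube N, s⁻¹ * total x ^ 2 - s⁻¹ ^ 3 / 4 * total x ^ 4 ≤ |total x| := by
    intro x
    have h := mul_nonneg hs.le (sub_sq_add_pow_four_nonneg (y := |total x| * s⁻¹) (by positivity))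
    have e : s * (|total x| * s⁻¹ - (|total x| * s⁻¹) ^ 2 + (|total x| * s⁻¹) ^ 4 / 4) =
        |total x| - (s⁻¹ * |total x| ^ 2 - s⁻¹ ^ 3 / 4 * |total x| ^ 4) := by
      field_simp
      ring
    rw [e, sq_abs, Even.pow_abs (by decide)] at h
    linarith
  have h := expectation_mono key
  rw [expectation_sub, expectation_const_mul, expectation_const_mul, expectation_total_sq,
    expectation_total_pow_four, ← hsN] at h
  refine le_trans ?_ h
  have : s⁻¹ * s ^ 2 - s⁻¹ ^ 3 / 4 * (3 * (s ^ 2) ^ 2 - 2 * s ^ 2) = s / 4 + s⁻¹ / 2 := by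
    field_simp
    ring
  rw [this]
  have := inv_pos.2 hs
  linarith

/-! ### Tails -/

/-- The indicator function of the half line `[a, ∞)`. -/
def tailInd (a t : ℝ) : ℝ := if a ≤ t then 1 else 0

lemma tailInd_nonneg (a t : ℝ) : 0 ≤ tailInd a t := by
  unfold tailInd; split_ifs <;> norm_num

lemma tailInd_le_one (a t : ℝ) : tailInd a t ≤ 1 := by
  unfold tailInd; split_ifs <;> norm_num

/-- `T` is symmetric, and the events `T ≥ 0` and `-T ≥ 0` cover the cube. -/
lemma half_le_expectation_tailInd_zero (N : ℕ) :
    1 / 2 ≤ expectation (fun x : Cube N => tailInd 0 (total x)) := by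
  have h : (1 : ℝ) ≤ expectation (fun x : Cube N => tailInd 0 (total x) + tailInd 0 (-total x)) := by
    rw [← expectation_const (N := N) 1]
    refine expectation_mono fun x => ?_
    unfold tailInd
    split_ifs <;> linarith
  rw [expectation_add, expectation_total_neg] at h
  linarith

/-- The exponential moment beyond a level is controlled by the tail probability. -/
lemma expectation_exp_mul_tailInd_le (l : ℝ) (N a : ℕ) :
    expectation (fun x : Cube N => Real.exp (l * total x) * tailInd a (total x)) ≤
      2 * Real.cosh l ^ N * Real.exp (l * a) *
        expectation (fun x : Cube N => tailInd a (total x)) := by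
  have hexp : ∀ N : ℕ, expectation (fun x : Cube N => Real.exp (l * total x)) = Real.cosh l ^ N := by
    intro N
    induction N with
    | zero => simp [total_zero, expectation_const]
    | succ N ih =>
      rw [expectation_total_succ (fun t => Real.exp (l * t))]
      have h1 : ∀ t : ℝ, Real.exp (l * (t + 1)) = Real.exp l * Real.exp (l * t) := by
        intro t; rw [← Real.exp_add]; ring_nf
      have h2 : ∀ t : ℝ, Real.exp (l * (t - 1)) = Real.exp (-l) * Real.exp (l * t) := by
        intro t; rw [← Real.exp_add]; ring_nf
      simp only [h1, h2, expectation_const_mul, ih, Real.cosh_eq]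
      ring
  -- Conditioning on one coordinate moves the level `a` to `a - 1` or `a + 1`; the factors `exp
  -- (±l)` exactly compensate the shift in `exp (l * a)`. At level `0` there is no recursion: the
  -- tail has probability at least `1/2`, which is the source of the factor `2`.
  induction N generalizing a with
  | zero =>
    simp only [total_zero, expectation_const]
    rcases Nat.eq_zero_or_pos a with rfl | ha
    · simp [tailInd]
    · have : tailInd (a : ℝ) 0 = 0 := by
        rw [tailInd, if_neg]; push Not; exact_mod_cast ha
      simp [this]
  | succ N ih =>
    rcases a with _ | b
    · have h1 := half_le_expectation_tailInd_zero (N + 1)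
      have h2 : expectation (fun x : Cube (N + 1) =>
          Real.exp (l * total x) * tailInd 0 (total x)) ≤ Real.cosh l ^ (N + 1) := by
        rw [← hexp]
        exact expectation_mono fun x =>
          mul_le_of_le_one_right (Real.exp_pos _).le (tailInd_le_one _ _)
      have h3 : 0 < Real.cosh l ^ (N + 1) := pow_pos (Real.cosh_pos l) _
      simp only [Nat.cast_zero, mul_zero, Real.exp_zero, mul_one]
      nlinarith
    · rw [expectation_total_succ (fun t => Real.exp (l * t) * tailInd ((b + 1 : ℕ) : ℝ) t),
        expectation_total_succ (fun t => tailInd ((b + 1 : ℕ) : ℝ) t)]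
      have h1 : ∀ t : ℝ, tailInd ((b + 1 : ℕ) : ℝ) (t + 1) = tailInd b t := by
        intro t; simp [tailInd]
      have h2 : ∀ t : ℝ, tailInd ((b + 1 : ℕ) : ℝ) (t - 1) = tailInd ((b + 2 : ℕ) : ℝ) t := by
        intro t; unfold tailInd; congr 1; push_cast; rw [le_sub_iff_add_le]; ring_nf
      have h3 : ∀ t : ℝ, Real.exp (l * (t + 1)) * tailInd b t =
          Real.exp l * (Real.exp (l * t) * tailInd b t) := by
        intro t; rw [← mul_assoc, ← Real.exp_add]; ring_nf
      have h4 : ∀ t : ℝ, Real.exp (l * (t - 1)) * tailInd ((b + 2 : ℕ) : ℝ) t =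
          Real.exp (-l) * (Real.exp (l * t) * tailInd ((b + 2 : ℕ) : ℝ) t) := by
        intro t; rw [← mul_assoc, ← Real.exp_add]; ring_nf
      simp only [h1, h2, h3, h4, expectation_const_mul]
      have i1 := mul_le_mul_of_nonneg_left (ih b) (Real.exp_pos l).le
      have i2 := mul_le_mul_of_nonneg_left (ih (b + 2)) (Real.exp_pos (-l)).le
      have e1 : Real.exp (l * ((b + 1 : ℕ) : ℝ)) = Real.exp l * Real.exp (l * b) := by
        rw [← Real.exp_add]; push_cast; ring_nf
      have e2 : Real.exp (l * ((b + 1 : ℕ) : ℝ)) =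
          Real.exp (-l) * Real.exp (l * ((b + 2 : ℕ) : ℝ)) := by
        rw [← Real.exp_add]; push_cast; ring_nf
      set u := expectation (fun x : Cube N => tailInd (b : ℝ) (total x))
      set v := expectation (fun x : Cube N => tailInd ((b + 2 : ℕ) : ℝ) (total x))
      have hu : 0 ≤ u := expectation_nonneg fun x => tailInd_nonneg _ _
      have hv : 0 ≤ v := expectation_nonneg fun x => tailInd_nonneg _ _
      set E := Real.exp (l * ((b + 1 : ℕ) : ℝ))
      have j1 : Real.exp l * (2 * Real.cosh l ^ N * Real.exp (l * b) * u) =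
          2 * Real.cosh l ^ N * E * u := by rw [e1]; ring
      have j2 : Real.exp (-l) * (2 * Real.cosh l ^ N * Real.exp (l * ((b + 2 : ℕ) : ℝ)) * v) =
          2 * Real.cosh l ^ N * E * v := by rw [e2]; ring
      have hc : Real.cosh l ^ N ≤ Real.cosh l ^ (N + 1) :=
        pow_le_pow_right₀ (Real.one_le_cosh l) (Nat.le_succ N)
      have hE : 0 ≤ E := (Real.exp_pos _).le
      have := mul_le_mul_of_nonneg_right hc (mul_nonneg hE (add_nonneg hu hv))
      rw [j1] at i1
      rw [j2] at i2
      linarith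

/-- The mean over a tail is at least the level and at least a multiple of `√N`. -/
lemma mul_expectation_tailInd_le (N : ℕ) (α : ℝ) (hα : 0 ≤ α) :
    (α + √(N : ℝ)) / 9 * expectation (fun x : Cube N => tailInd α (total x)) ≤
      expectation (fun x : Cube N => total x * tailInd α (total x)) := by
  set p := expectation (fun x : Cube N => tailInd α (total x)) with hp
  have hp0 : 0 ≤ p := expectation_nonneg fun x => tailInd_nonneg _ _
  have h1 : α * p ≤ expectation (fun x : Cube N => total x * tailInd α (total x)) := by
    rw [hp, ← expectation_const_mul]
    refine expectation_mono fun x => ?_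
    unfold tailInd; split_ifs <;> simp_all
  have h2 : √(N : ℝ) / 8 * p ≤
      expectation (fun x : Cube N => total x * tailInd α (total x)) := by
    rcases le_or_gt (√(N : ℝ) / 8) α with h | h
    · exact (mul_le_mul_of_nonneg_right h hp0).trans h1
    set m := √(N : ℝ) / 8 with hm8
    have hm : 0 ≤ m := by positivity
    -- The left side is the positive part of `T` minus `m`. Off the tail it is nonpositive because
    -- `T < α < m`. Its mean is nonnegative since `m` is half the Khinchine bound.
    have key : ∀ x : Cube N, (|total x| / 2 + (1 / 2) * total x) - m ≤
        total x * tailInd α (total x) - m * tailInd α (total x) := by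
      intro x
      unfold tailInd
      split_ifs with hx
      · rw [abs_of_nonneg (hα.trans hx)]; linarith
      · rcases abs_cases (total x) with ⟨e, -⟩ | ⟨e, -⟩ <;> rw [e] <;> linarith
    have h := expectation_mono key
    have ho : expectation (fun x : Cube N => total x) = 0 := by
      have := expectation_total_neg (N := N) (fun t => t)
      have h' := expectation_const_mul (N := N) (-1) (fun x => total x)
      simp only [neg_one_mul] at h'
      linarith
    rw [expectation_sub, expectation_sub, expectation_const, expectation_add,
      expectation_const_mul, expectation_const_mul, ho, ← hp] at h
    have h3 := expectation_const_mul (N := N) (1 / 2) (fun x => |total x|)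
    have h4 : (fun x : Cube N => 1 / 2 * |total x|) = fun x => |total x| / 2 := by ext; ring
    rw [h4] at h3
    rw [h3] at h
    have h5 := sqrt_div_four_le_expectation_abs_total N
    linarith
  -- `h1` plus eight times `h2` gives the constant `9`.
  linarith

/-- If the first coordinate is `-1` and the others have sum at most `0`, then `T < α`. This keeps
the coefficient at `∅` away from `1` when `p > 1/2`. -/
lemma quarter_le_expectation_one_sub_tailInd (N : ℕ) (hN : 0 < N) (α : ℝ) (hα : 0 ≤ α) :
    1 / 4 ≤ expectation (fun x : Cube N => 1 - tailInd α (total x)) := by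
  obtain ⟨M, rfl⟩ := Nat.exists_eq_succ_of_ne_zero hN.ne'
  rw [Nat.succ_eq_add_one, expectation_total_succ (fun t => 1 - tailInd α t)]
  have h1 : 0 ≤ expectation (fun x : Cube M => 1 - tailInd α (total x + 1)) :=
    expectation_nonneg fun x => sub_nonneg.2 (tailInd_le_one _ _)
  have h2 : expectation (fun x : Cube M => tailInd 0 (-total x)) ≤
      expectation (fun x : Cube M => 1 - tailInd α (total x - 1)) := by
    refine expectation_mono fun x => ?_
    unfold tailInd
    split_ifs <;> linarith
  rw [expectation_total_neg] at h2
  have h3 := half_le_expectation_tailInd_zero M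
  linarith

/-! ### Coefficientwise majorants -/

/-- `Q` majorizes `P` coefficientwise. -/
def Majorizes (Q P : Polynomial ℝ) : Prop := ∀ d, |P.coeff d| ≤ Q.coeff d

lemma Majorizes.one : Majorizes 1 1 := by
  intro d
  rw [Polynomial.coeff_one]
  split_ifs <;> simp

lemma Majorizes.mul {P P' Q Q' : Polynomial ℝ} (h : Majorizes Q P) (h' : Majorizes Q' P') :
    Majorizes (Q * Q') (P * P') := by
  intro d
  rw [Polynomial.coeff_mul, Polynomial.coeff_mul]
  refine (Finset.abs_sum_le_sum_abs _ _).trans (Finset.sum_le_sum fun i _ => ?_)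
  rw [abs_mul]
  exact mul_le_mul (h _) (h' _) (abs_nonneg _) ((abs_nonneg _).trans (h _))

lemma Majorizes.pow {P Q : Polynomial ℝ} (h : Majorizes Q P) (n : ℕ) :
    Majorizes (Q ^ n) (P ^ n) := by
  induction n with
  | zero => simpa using Majorizes.one
  | succ n ih => rw [pow_succ, pow_succ]; exact ih.mul h

lemma Majorizes.sum_le_eval {P Q : Polynomial ℝ} (h : Majorizes Q P) {r : ℝ} (hr : 0 ≤ r)
    (n : ℕ) : ∑ d ∈ Finset.range n, |P.coeff d| * r ^ d ≤ Q.eval r := by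
  rw [Polynomial.eval_eq_sum_range' (n := max n (Q.natDegree + 1)) (by omega)]
  refine (Finset.sum_le_sum fun d _ => mul_le_mul_of_nonneg_right (h d) (pow_nonneg hr d)).trans
    (Finset.sum_le_sum_of_subset_of_nonneg (Finset.range_mono (le_max_left _ _)) ?_)
  exact fun d _ _ => mul_nonneg ((abs_nonneg _).trans (h d)) (pow_nonneg hr d)

/-! ### Elementary symmetric functions of a point of the cube -/

open Polynomial in
/-- The generating polynomial `∏ k, (1 + x k * X)` of the elementary symmetric functions. -/
def genPoly {N : ℕ} (x : Cube N) : ℝ[X] := ∏ k, (1 + C (coord x k) * X)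

lemma coeff_genPoly {N : ℕ} (x : Cube N) (d : ℕ) :
    (genPoly x).coeff d =
      ∑ S ∈ (Finset.univ : Finset (Finset (Fin N))).filter (fun S => S.card = d), walsh S x := by
  rw [genPoly, Finset.prod_one_add, Polynomial.finsetSum_coeff, Finset.sum_filter,
    Finset.powerset_univ]
  refine Finset.sum_congr rfl fun S _ => ?_
  rw [Finset.prod_mul_distrib, Finset.prod_const, ← map_prod, Polynomial.coeff_C_mul_X_pow]
  simp only [eq_comm, walsh]

open Polynomial in
-- Each coordinate `-1` is paired with a `1`, producing `1 - X ^ 2`; the `s = T` unpaired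
-- coordinates equal `1`.
lemma genPoly_eq {N : ℕ} (x : Cube N) (hx : 0 ≤ total x) :
    ∃ q s : ℕ, 2 * q + s = N ∧ total x = s ∧
      genPoly x = (1 - X ^ 2) ^ q * (1 + X) ^ s := by
  classical
  set A := (Finset.univ : Finset (Fin N)).filter (fun k => x k = 1)
  set B := (Finset.univ : Finset (Fin N)).filter (fun k => ¬ x k = 1)
  have hcard : A.card + B.card = N := by
    simpa using Finset.card_filter_add_card_filter_not (s := Finset.univ) (fun k => x k = 1)
  have hc : ∀ k, coord x k = if x k = 1 then 1 else -1 := by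
    intro k
    rcases Int.units_eq_one_or (x k) with h | h <;> simp [coord, h]
  have ht : total x = A.card - B.card := by
    simp only [total, hc, Finset.sum_ite, Finset.sum_const, nsmul_eq_mul]
    ring
  have hg : genPoly x = (1 + X) ^ A.card * (1 - X) ^ B.card := by
    have : genPoly x = ∏ k, if x k = 1 then (1 + X : ℝ[X]) else 1 - X := by
      refine Finset.prod_congr rfl fun k _ => ?_
      rw [hc]
      split_ifs
      · simp
      · simp [sub_eq_add_neg]
    rw [this, Finset.prod_ite, Finset.prod_const, Finset.prod_const]
  have hBA : B.card ≤ A.card := by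
    rw [ht, sub_nonneg] at hx
    exact_mod_cast hx
  obtain ⟨s, hs⟩ := Nat.exists_eq_add_of_le hBA
  refine ⟨B.card, s, by omega, by rw [ht, hs]; push_cast; ring, ?_⟩
  rw [hg, hs, pow_add, mul_right_comm, ← mul_pow]
  congr 2
  ring

open Polynomial in
-- Majorizing after the pairing replaces `1 - X ^ 2` by `1 + X ^ 2`, so cancellation leaves `r ^ 2 *
-- N` in the exponent where the unpaired product would give `r * N`.
lemma sum_abs_coeff_genPoly_le {N : ℕ} (x : Cube N) (hx : 0 ≤ total x) {r : ℝ} (hr : 0 ≤ r)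
    (n : ℕ) : ∑ d ∈ Finset.range n, |(genPoly x).coeff d| * r ^ d ≤
      Real.exp (r ^ 2 * N / 2 + r * total x) := by
  obtain ⟨q, s, hN, ht, hg⟩ := genPoly_eq x hx
  have h1 : Majorizes (1 + X ^ 2) (1 - X ^ 2) := by
    intro d
    rw [coeff_sub, coeff_add, coeff_one, coeff_X_pow]
    split_ifs <;> first | omega | norm_num
  have h2 : Majorizes (1 + X) (1 + X) := by
    intro d
    rw [coeff_add, coeff_one, coeff_X]
    split_ifs <;> first | omega | norm_num
  have h3 := ((h1.pow q).mul (h2.pow s)).sum_le_eval hr n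
  rw [hg]
  refine h3.trans ?_
  simp only [eval_mul, eval_pow, eval_add, eval_one, eval_X]
  have e : Real.exp (r ^ 2 * N / 2 + r * total x) ≥ Real.exp (r ^ 2) ^ q * Real.exp r ^ s := by
    rw [← Real.exp_nat_mul, ← Real.exp_nat_mul, ← Real.exp_add, ht]
    apply Real.exp_le_exp.2
    have : 2 * (q : ℝ) + s = N := by exact_mod_cast hN
    have hs : (0 : ℝ) ≤ s := by positivity
    nlinarith [mul_nonneg (sq_nonneg r) hs]
  refine le_trans ?_ e
  have a1 := Real.add_one_le_exp (r ^ 2)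
  have a2 := Real.add_one_le_exp r
  rw [add_comm] at a1 a2
  gcongr

/-! ### Walsh coefficients of symmetric functions -/

lemma expectation_walsh {N : ℕ} (S : Finset (Fin N)) (hS : S.Nonempty) :
    expectation (walsh S) = 0 := by
  obtain ⟨k, hk⟩ := hS
  -- Translation by `y` flips one coordinate of `S`, hence the sign of the Walsh function.
  set y : Cube N := Function.update 1 k (-1) with hy
  have hmul : ∀ x : Cube N, walsh S (x * y) = -1 * walsh S x := by
    intro x
    have h1 : walsh S (x * y) = walsh S x * walsh S y := by
      simp [walsh, coord, Finset.prod_mul_distrib]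
    have h2 : walsh S y = -1 := by
      rw [walsh, Finset.prod_eq_single k]
      · simp [coord, hy]
      · intro j _ hj; simp [coord, hy, hj]
      · exact fun h => absurd hk h
    rw [h1, h2]; ring
  have h := expectation_comp_equiv (Equiv.mulRight y) (walsh S)
  simp only [Equiv.coe_mulRight, hmul, expectation_const_mul] at h
  linarith

/-- A permutation of the coordinates carrying `S` to `T` leaves the total unchanged. -/
lemma walshCoeff_eq_of_card_eq {N : ℕ} (g : ℝ → ℝ) {S T : Finset (Fin N)}
    (h : S.card = T.card) :
    walshCoeff (fun x => g (total x)) S = walshCoeff (fun x => g (total x)) T := by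
  let e : {k // k ∈ S} ≃ {k // k ∈ T} := Finset.equivOfCardEq h
  let σ : Equiv.Perm (Fin N) := e.extendSubtype
  have hσ : S.map σ.toEmbedding = T := by
    apply Finset.eq_of_subset_of_card_le
    · intro j hj
      obtain ⟨k, hk, rfl⟩ := Finset.mem_map.1 hj
      exact e.extendSubtype_mem k hk
    · rw [Finset.card_map, h]
  unfold walshCoeff
  rw [← expectation_comp_equiv (Equiv.arrowCongr σ (Equiv.refl _))
    (fun x => g (total x) * walsh T x)]
  congr 1
  ext x
  have h1 : total (Equiv.arrowCongr σ (Equiv.refl _) x) = total x := by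
    simp only [total, coord, Equiv.arrowCongr_apply, Equiv.coe_refl, Function.comp_apply, id]
    exact Equiv.sum_comp σ.symm (fun k => ((x k : ℤ) : ℝ))
  have h2 : walsh T (Equiv.arrowCongr σ (Equiv.refl _) x) = walsh S x := by
    rw [← hσ]
    simp [walsh, coord]
  rw [h1, h2]

/-- All coefficients on one level coincide, so no cancellation occurs and the absolute value can be
taken outside the sum. -/
lemma sum_abs_walshCoeff_eq {N : ℕ} (g : ℝ → ℝ) (d : ℕ) :
    ∑ S ∈ (Finset.univ : Finset (Finset (Fin N))).filter (fun S => S.card = d),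
      |walshCoeff (fun x => g (total x)) S| =
    |expectation fun x : Cube N => g (total x) * (genPoly x).coeff d| := by
  have h : (expectation fun x : Cube N => g (total x) * (genPoly x).coeff d) =
      ∑ S ∈ (Finset.univ : Finset (Finset (Fin N))).filter (fun S => S.card = d),
        walshCoeff (fun x => g (total x)) S := by
    simp only [coeff_genPoly, Finset.mul_sum, walshCoeff]
    rw [expectation_sum]
  rw [h]
  set F := (Finset.univ : Finset (Finset (Fin N))).filter (fun S => S.card = d)
  rcases F.eq_empty_or_nonempty with h0 | ⟨T, hT⟩
  · simp [h0]
  · have hc : ∀ S ∈ F, walshCoeff (fun x => g (total x)) S =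
        walshCoeff (fun x => g (total x)) T := fun S hS =>
      walshCoeff_eq_of_card_eq g
        ((Finset.mem_filter.1 hS).2.trans (Finset.mem_filter.1 hT).2.symm)
    rw [Finset.sum_congr rfl hc, Finset.sum_congr rfl fun S hS => by rw [hc S hS],
      Finset.sum_const, Finset.sum_const, nsmul_eq_mul, nsmul_eq_mul, abs_mul, Nat.abs_cast]

/-! ### The threshold function -/

lemma threshold_eq {N : ℕ} (α : ℝ) :
    threshold N α = fun x => 2 * tailInd α (total x) - 1 := by
  ext x
  have h0 : threshold N α x = if 0 ≤ total x - α then 1 else -1 := rfl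
  rw [h0, tailInd]
  split_ifs <;> linarith

lemma supNorm_threshold (N : ℕ) (α : ℝ) : supNorm (threshold N α) = 1 := by
  have : ∀ x, |threshold N α x| = 1 := by
    intro x; unfold threshold sgn; split_ifs <;> simp
  simp [supNorm, this]

lemma walshCoeff_threshold_empty (N : ℕ) (α : ℝ) :
    walshCoeff (threshold N α) ∅ =
      2 * expectation (fun x : Cube N => tailInd α (total x)) - 1 := by
  simp only [walshCoeff, threshold_eq, walsh, Finset.prod_empty, mul_one]
  rw [expectation_sub, expectation_const_mul, expectation_const]

lemma walshCoeff_threshold {N : ℕ} (α : ℝ) {S : Finset (Fin N)} (hS : S.Nonempty) :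
    walshCoeff (threshold N α) S =
      2 * walshCoeff (fun x => tailInd α (total x)) S := by
  have : ∀ x : Cube N, (2 * tailInd α (total x) - 1) * walsh S x =
      2 * (tailInd α (total x) * walsh S x) - walsh S x := fun x => by ring
  simp only [walshCoeff, threshold_eq, this]
  rw [expectation_sub, expectation_const_mul, expectation_walsh S hS, sub_zero]

/-- The part of the Boolean radius sum over nonempty sets. -/
lemma sum_erase_empty_le {N : ℕ} {α r : ℝ} (hα : 0 ≤ α) (hr : 0 ≤ r) :
    ∑ S ∈ Finset.univ.erase (∅ : Finset (Fin N)), |walshCoeff (threshold N α) S| * r ^ S.card ≤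
      2 * expectation (fun x : Cube N =>
        tailInd α (total x) * (Real.exp (r ^ 2 * N / 2 + r * total x) - 1)) := by
  have h1 : ∑ S ∈ Finset.univ.erase (∅ : Finset (Fin N)),
      |walshCoeff (threshold N α) S| * r ^ S.card =
      2 * ∑ S ∈ Finset.univ.erase (∅ : Finset (Fin N)),
        |walshCoeff (fun x => tailInd α (total x)) S| * r ^ S.card := by
    rw [Finset.mul_sum]
    refine Finset.sum_congr rfl fun S hS => ?_
    rw [walshCoeff_threshold α (Finset.nonempty_iff_ne_empty.2 (Finset.ne_of_mem_erase hS)),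
      abs_mul, abs_two, mul_assoc]
  rw [h1]
  refine mul_le_mul_of_nonneg_left ?_ zero_le_two
  have h2 : ∑ S : Finset (Fin N), |walshCoeff (fun x => tailInd α (total x)) S| * r ^ S.card =
      ∑ d ∈ Finset.range (N + 1),
        |expectation fun x : Cube N => tailInd α (total x) * (genPoly x).coeff d| * r ^ d := by
    rw [← Finset.sum_fiberwise_of_maps_to (g := Finset.card) (t := Finset.range (N + 1))
      (fun S _ => Finset.mem_range.2 (Nat.lt_succ_of_le (by simpa using S.card_le_univ)))]
    refine Finset.sum_congr rfl fun d _ => ?_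
    rw [← sum_abs_walshCoeff_eq, Finset.sum_mul]
    refine Finset.sum_congr rfl fun S hS => ?_
    rw [(Finset.mem_filter.1 hS).2]
  have hp : 0 ≤ expectation (fun x : Cube N => tailInd α (total x)) :=
    expectation_nonneg fun x => tailInd_nonneg _ _
  have h3 : |walshCoeff (fun x : Cube N => tailInd α (total x)) ∅| * r ^ (∅ : Finset (Fin N)).card =
      expectation (fun x : Cube N => tailInd α (total x)) := by
    simp only [walshCoeff, walsh, Finset.prod_empty, mul_one, Finset.card_empty, pow_zero]
    exact abs_of_nonneg hp
  have h4 := Finset.add_sum_erase Finset.univ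
    (fun S : Finset (Fin N) => |walshCoeff (fun x => tailInd α (total x)) S| * r ^ S.card)
    (Finset.mem_univ ∅)
  -- Removing the empty set subtracts `p`, which becomes the `- 1` next to the exponential.
  rw [h2, h3] at h4
  have h5 : ∑ d ∈ Finset.range (N + 1),
        |expectation fun x : Cube N => tailInd α (total x) * (genPoly x).coeff d| * r ^ d ≤
      expectation (fun x : Cube N =>
        tailInd α (total x) * Real.exp (r ^ 2 * N / 2 + r * total x)) := by
    have h6 : ∀ d ∈ Finset.range (N + 1),
        |expectation fun x : Cube N => tailInd α (total x) * (genPoly x).coeff d| * r ^ d ≤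
        expectation fun x : Cube N => r ^ d * (tailInd α (total x) * |(genPoly x).coeff d|) := by
      intro d _
      rw [expectation_const_mul, mul_comm]
      refine mul_le_mul_of_nonneg_left ((abs_expectation_le _).trans_eq ?_) (pow_nonneg hr d)
      simp only [abs_mul, abs_of_nonneg (tailInd_nonneg _ _)]
    refine (Finset.sum_le_sum h6).trans ?_
    rw [← expectation_sum]
    refine expectation_mono fun x => ?_
    by_cases hx : α ≤ total x
    · simp only [tailInd, if_pos hx, one_mul]
      refine le_trans (le_of_eq ?_) (sum_abs_coeff_genPoly_le x (hα.trans hx) hr (N + 1))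
      exact Finset.sum_congr rfl fun d _ => mul_comm _ _
    · simp [tailInd, hx]
  have h7 : (fun x : Cube N =>
        tailInd α (total x) * (Real.exp (r ^ 2 * N / 2 + r * total x) - 1)) =
      fun x => tailInd α (total x) * Real.exp (r ^ 2 * N / 2 + r * total x) -
        tailInd α (total x) := by ext; ring
  rw [h7, expectation_sub]
  linarith

/-- Integrality of the total allows the integer levels needed for the induction on tails. -/
lemma tailInd_total_eq_ceil {N : ℕ} {α : ℝ} (hα : 0 ≤ α) (x : Cube N) :
    tailInd α (total x) = tailInd (⌈α⌉₊ : ℝ) (total x) := by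
  obtain ⟨z, hz⟩ := total_eq_intCast x
  have : α ≤ total x ↔ (⌈α⌉₊ : ℝ) ≤ total x := by
    rw [hz]
    constructor
    · intro h
      have hz0 : (0 : ℤ) ≤ z := by exact_mod_cast hα.trans h
      obtain ⟨n, rfl⟩ := Int.eq_ofNat_of_zero_le hz0
      have h' : α ≤ (n : ℝ) := by exact_mod_cast h
      exact_mod_cast Nat.ceil_le.2 h'
    · exact (Nat.le_ceil α).trans
  simp only [tailInd, this]

/-- Below a multiple of `1 / (α + √N)` the sum over nonempty sets is small. -/
lemma sum_erase_empty_lt {N : ℕ} {α r : ℝ} (hN : 0 < N) (hα : 0 ≤ α) (hr : 0 ≤ r)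
    (hrs : r ≤ 1 / 128 * (1 / (α + √(N : ℝ))))
    (hp : 0 < expectation (fun x : Cube N => tailInd α (total x))) :
    ∑ S ∈ Finset.univ.erase (∅ : Finset (Fin N)), |walshCoeff (threshold N α) S| * r ^ S.card <
      expectation (fun x : Cube N => tailInd α (total x)) / 2 := by
  set p := expectation (fun x : Cube N => tailInd α (total x)) with hpdef
  have hN1 : (1 : ℝ) ≤ N := by exact_mod_cast hN
  have hs1 : 1 ≤ √(N : ℝ) := Real.one_le_sqrt.2 hN1
  have hsN : √(N : ℝ) ^ 2 = N := Real.sq_sqrt (by positivity)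
  set s := √(N : ℝ)
  set a := ⌈α⌉₊
  have haα : (a : ℝ) ≤ α + 1 := (Nat.ceil_lt_add_one hα).le
  have ha0 : (0 : ℝ) ≤ a := by positivity
  -- With this `l` both `cosh l ^ N ≤ exp (1/2)` and `exp (l * a) ≤ exp 1`. Since `a ≤ α + 1` and `s
  -- ≥ 1`, rounding costs at most a factor `2`, turning `1/128` into `1/64`.
  set l := 1 / ((a : ℝ) + s) with hl
  have hl0 : 0 < l := by positivity
  have hls : l * s ≤ 1 := by rw [hl, one_div, inv_mul_le_one₀ (by positivity)]; linarith
  have hla : l * a ≤ 1 := by rw [hl, one_div, inv_mul_le_one₀ (by positivity)]; linarith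
  have hrl : r ≤ 1 / 64 * l := by
    refine hrs.trans ?_
    have : 1 / (α + s) ≤ 2 * l := by
      rw [hl, mul_one_div, div_le_div_iff₀ (by positivity) (by positivity)]
      linarith
    linarith
  have hls2 : l ^ 2 * N ≤ 1 := by
    rw [← hsN, ← mul_pow]; exact pow_le_one₀ (by positivity) hls
  have hpoint : ∀ x : Cube N,
      tailInd α (total x) * (Real.exp (r ^ 2 * N / 2 + r * total x) - 1) ≤
        1 / 64 * Real.exp (1 / 2) * (Real.exp (l * total x) * tailInd a (total x)) := by
    intro x
    rw [← tailInd_total_eq_ceil hα]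
    by_cases hx : α ≤ total x
    · simp only [tailInd, if_pos hx, one_mul, mul_one]
      have ht := hα.trans hx
      have h1 : r ^ 2 * N / 2 + r * total x ≤ 1 / 64 * (1 / 2 + l * total x) := by
        have i1 : r ^ 2 ≤ 1 / 64 * l ^ 2 := by nlinarith
        have i2 : r ^ 2 * N ≤ 1 / 64 * l ^ 2 * N := mul_le_mul_of_nonneg_right i1 (by positivity)
        have i3 : r * total x ≤ 1 / 64 * l * total x := mul_le_mul_of_nonneg_right hrl ht
        linarith
      set u := 1 / 2 + l * total x with hu
      -- Convexity between `u` and `0` extracts the small factor `1/64` from `exp - 1`.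
      have h2 : Real.exp (1 / 64 * u) ≤ 1 / 64 * Real.exp u + 63 / 64 := by
        have := convexOn_exp.2 (Set.mem_univ u) (Set.mem_univ 0)
          (by norm_num : (0 : ℝ) ≤ 1 / 64) (by norm_num : (0 : ℝ) ≤ 63 / 64) (by norm_num)
        simpa using this
      have h3 := Real.exp_le_exp.2 h1
      have h4 : Real.exp u = Real.exp (1 / 2) * Real.exp (l * total x) := by
        rw [hu, Real.exp_add]
      rw [mul_assoc, ← h4]
      linarith
    · simp [tailInd, hx]
  have h := expectation_mono hpoint
  rw [expectation_const_mul] at h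
  have htail := expectation_exp_mul_tailInd_le l N a
  have hpa : expectation (fun x : Cube N => tailInd (a : ℝ) (total x)) = p := by
    rw [hpdef]; congr 1; ext x; exact (tailInd_total_eq_ceil hα x).symm
  rw [hpa] at htail
  have hcosh : Real.cosh l ^ N ≤ Real.exp (1 / 2) := by
    refine (pow_le_pow_left₀ (Real.cosh_pos l).le (Real.cosh_le_exp_half_sq l) N).trans ?_
    rw [← Real.exp_nat_mul]
    apply Real.exp_le_exp.2
    linarith
  have hmain : expectation (fun x : Cube N => Real.exp (l * total x) * tailInd a (total x)) ≤
      2 * Real.exp (1 / 2) * Real.exp 1 * p := by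
    refine htail.trans ?_
    have := Real.exp_le_exp.2 hla
    gcongr
  have hfin := sum_erase_empty_le (N := N) hα hr
  -- The total constant is `2 · (1/64) · 2e² = e²/16`, so `e² < 8` gives the bound `p/2`.
  have he : Real.exp (1 / 2) * (Real.exp (1 / 2) * Real.exp 1) < 8 := by
    have e1 : Real.exp (1 / 2) * (Real.exp (1 / 2) * Real.exp 1) = Real.exp 1 * Real.exp 1 := by
      rw [← mul_assoc, ← Real.exp_add]; norm_num
    rw [e1]
    have := Real.exp_one_lt_d9
    nlinarith [Real.exp_pos 1]
  have h8 := mul_le_mul_of_nonneg_left hmain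
    (by positivity : 0 ≤ 1 / 64 * Real.exp (1 / 2))
  have h9 := mul_lt_mul_of_pos_right he hp
  linarith

lemma walsh_singleton {N : ℕ} (k : Fin N) (x : Cube N) : walsh {k} x = coord x k := by
  simp [walsh]

lemma sum_walshCoeff_singleton {N : ℕ} (α : ℝ) :
    ∑ k : Fin N, walshCoeff (threshold N α) {k} =
      2 * expectation (fun x : Cube N => total x * tailInd α (total x)) := by
  simp only [fun k : Fin N => walshCoeff_threshold α (Finset.singleton_nonempty k)]
  rw [← Finset.mul_sum]
  simp only [walshCoeff, walsh_singleton]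
  rw [← expectation_sum]
  simp only [← Finset.mul_sum]
  congr 2
  ext x
  exact mul_comm _ _

/-- The first two levels of the Boolean radius sum. -/
lemma first_levels_le {N : ℕ} {α r : ℝ} (hr : 0 ≤ r) :
    |walshCoeff (threshold N α) ∅| +
        2 * expectation (fun x : Cube N => total x * tailInd α (total x)) * r ≤
      ∑ S : Finset (Fin N), |walshCoeff (threshold N α) S| * r ^ S.card := by
  rw [← Finset.add_sum_erase _ _ (Finset.mem_univ ∅), Finset.card_empty, pow_zero, mul_one,
    ← sum_walshCoeff_singleton, Finset.sum_mul]
  refine add_le_add_right ?_ _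
  calc ∑ k : Fin N, walshCoeff (threshold N α) {k} * r
      ≤ ∑ k : Fin N, |walshCoeff (threshold N α) {k}| * r ^ ({k} : Finset (Fin N)).card := by
        refine Finset.sum_le_sum fun k _ => ?_
        rw [Finset.card_singleton, pow_one]
        exact mul_le_mul_of_nonneg_right (le_abs_self _) hr
    _ = ∑ S ∈ Finset.univ.image (fun k : Fin N => ({k} : Finset (Fin N))),
          |walshCoeff (threshold N α) S| * r ^ S.card :=
        (Finset.sum_image (f := fun S : Finset (Fin N) => |walshCoeff (threshold N α) S| * r ^ S.card)
          fun i _ j _ h => Finset.singleton_injective h).symm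
    _ ≤ _ := by
        refine Finset.sum_le_sum_of_subset_of_nonneg ?_ fun S _ _ => by positivity
        intro S hS
        obtain ⟨k, -, rfl⟩ := Finset.mem_image.1 hS
        simp

end BooleanCube

end

theorem mainTheorem10 :
    ∃ C : ℝ, 0 < C ∧ ∀ (N : ℕ) (α : ℝ), 0 ≤ α → α < (N : ℝ) →
      (∃! ρ : ℝ, BooleanCube.IsBooleanRadius (BooleanCube.threshold N α) ρ) ∧
      ∀ ρ : ℝ, BooleanCube.IsBooleanRadius (BooleanCube.threshold N α) ρ →
        C⁻¹ * (1 / (α + √(N : ℝ))) ≤ ρ ∧ ρ ≤ C * (1 / (α + √(N : ℝ))) := by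
  open BooleanCube in
  -- The lower bound dictates `128`; the upper bound would hold with `9`.
  refine ⟨128, by norm_num, fun N α hα hαN => ?_⟩
  have hNpos : 0 < N := by exact_mod_cast hα.trans_lt hαN
  have hs : 0 < √(N : ℝ) := Real.sqrt_pos.2 (by exact_mod_cast hNpos)
  set p := expectation (fun x : Cube N => tailInd α (total x)) with hpdef
  set m := expectation (fun x : Cube N => total x * tailInd α (total x)) with hmdef
  have hp : 0 < p := by
    refine expectation_pos (fun x => tailInd_nonneg _ _) (y := 1) ?_
    have : total (1 : Cube N) = N := by simp [total, coord]
    simp [tailInd, this, hαN.le]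
  have hm : (α + √(N : ℝ)) / 9 * p ≤ m := mul_expectation_tailInd_le N α hα
  have hq := quarter_le_expectation_one_sub_tailInd N hNpos α hα
  rw [expectation_sub, expectation_const, ← hpdef] at hq
  have hmpos : 0 < m := lt_of_lt_of_le (by positivity) hm
  have hc0 : |walshCoeff (threshold N α) ∅| ≤ 1 - p / 2 := by
    rw [walshCoeff_threshold_empty, ← hpdef, abs_le]
    constructor <;> linarith
  have hc0' : 1 - 2 * p ≤ |walshCoeff (threshold N α) ∅| := by
    rw [walshCoeff_threshold_empty, ← hpdef, abs_sub_comm]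
    exact le_abs_self _
  set F : ℝ → ℝ := fun r => ∑ S : Finset (Fin N), |walshCoeff (threshold N α) S| * r ^ S.card
    with hF
  have hrad : ∀ r, IsBooleanRadius (threshold N α) r ↔ 0 < r ∧ F r = 1 := by
    intro r; rw [IsBooleanRadius, supNorm_threshold]
  have hsmall : ∀ r, 0 ≤ r → r ≤ 1 / 128 * (1 / (α + √(N : ℝ))) → F r < 1 := by
    intro r hr hrs
    have h := sum_erase_empty_lt hNpos hα hr hrs hp
    have h' : F r = _ := (Finset.add_sum_erase _ _ (Finset.mem_univ ∅)).symm
    rw [Finset.card_empty, pow_zero, mul_one] at h'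
    linarith
  have hlevel : ∀ r, 0 ≤ r → 1 - 2 * p + 2 * m * r ≤ F r := fun r hr => by
    have := first_levels_le (N := N) (α := α) hr
    linarith
  have hmono : ∀ r t, 0 < r → r < t → F r < F t := by
    intro r t hr hrt
    -- The first-level coefficients sum to `2m > 0`, so one of them is positive and its term is
    -- strictly increasing.
    obtain ⟨k, -, hk⟩ : ∃ k ∈ Finset.univ, (0 : ℝ) < walshCoeff (threshold N α) {k} := by
      apply Finset.exists_lt_of_sum_lt (f := fun _ : Fin N => (0 : ℝ))
      rw [Finset.sum_const_zero, sum_walshCoeff_singleton]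
      positivity
    refine Finset.sum_lt_sum (fun S _ => ?_) ⟨{k}, Finset.mem_univ _, ?_⟩
    · gcongr
    · rw [Finset.card_singleton, pow_one, pow_one]
      exact mul_lt_mul_of_pos_left hrt (abs_pos.2 hk.ne')
  have hcont : Continuous F := by
    rw [hF]; fun_prop
  refine ⟨?_, fun r hr => ?_⟩
  -- `p / m` is where the linear minorant `1 - 2p + 2mr` reaches `1`.
  · have hb : 1 ≤ F (p / m) := by
      have := hlevel (p / m) (by positivity)
      have e : 2 * m * (p / m) = 2 * p := by field_simp
      linarith
    obtain ⟨r, ⟨hr0, -⟩, hr⟩ := intermediate_value_Icc (by positivity : 0 ≤ p / m)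
      hcont.continuousOn ⟨(hsmall 0 le_rfl (by positivity)).le, hb⟩
    have hrpos : 0 < r := by
      rcases hr0.eq_or_lt with h | h
      · have := hsmall 0 le_rfl (by positivity)
        rw [h, hr] at this
        exact absurd this (lt_irrefl _)
      · exact h
    refine ⟨r, (hrad r).2 ⟨hrpos, hr⟩, fun t ht => ?_⟩
    obtain ⟨ht0, ht1⟩ := (hrad t).1 ht
    rcases lt_trichotomy t r with h | h | h
    · have := hmono t r ht0 h; linarith
    · exact h
    · have := hmono r t hrpos h; linarith
  · obtain ⟨hr0, hr1⟩ := (hrad r).1 hr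
    constructor
    · by_contra! h
      have := hsmall r hr0.le (by linarith)
      linarith
    · have h1 := hlevel r hr0.le
      have h2 : m * r ≤ p := by linarith
      have h3 : (α + √(N : ℝ)) / 9 * r ≤ 1 := by
        have := mul_le_mul_of_nonneg_right hm hr0.le
        refine le_of_mul_le_mul_right ?_ hp
        linarith
      rw [mul_one_div, le_div_iff₀ (by positivity)]
      linarith
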